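/- Let $n\ge 1$ be an integer, $u>0$ a real number, and $$\Delta^{n,u}=\{\theta\in\mathbb{R}^n : \theta_1+\cdots+\theta_n=u,\ \theta_i\ge 0 \text{ for } 1\le i\le n\}.$$ For $\theta,\theta'\in\Delta^{n,u}$ write $\theta\le_{\mathrm{hr}}\theta'$ (hazard rate order) if $$\Big(\sum_{k=i}^n\theta_k\Big)\Big(\sum_{k=j}^n\theta'_k\Big)\ \ge\ \Big(\sum_{k=j}^n\theta_k\Big)\Big(\sum_{k=i}^n\theta'_k\Big)\qquad\text{for all } 1\le i\le j\le n.$$ Let $\Theta$ and $\Theta'$ be independent random vectors, each uniformly distributed on $\Delta^{n,u}$ (with respect to $(n-1)$-dimensional volume). Then $$P(\Theta\le_{\mathrm{hr}}\Theta')=\frac{1}{2^{n-1}}.$$ Moreover, given real numbers $x_1<\cdots<x_n$, let $P_\theta=\sum_{i=1}^n\theta_i\,\delta_{x_i}$ be the measure on $\mathbb{R}$ that gives mass $\theta_i$ to $x_i$ (for $u=1$, the probability distribution induced by the element $\theta$ of the probability simplex), and for finite measures $\mu,\nu$ on $\mathbb{R}$ write $\mu\le_{\mathrm{hr}}\nu$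 if $\mu((s,\infty))\,\nu((t,\infty))\ge\mu((t,\infty))\,\nu((s,\infty))$ for all real $s\le t$. Then also $$P(P_\Theta\le_{\mathrm{hr}}P_{\Theta'})=\frac{1}{2^{n-1}}.$$ -/

import Mathlib

open MeasureTheory ProbabilityTheory
open scoped ENNReal MeasureTheory

/-- The scaled simplex `Δ^{n,u}`: vectors in `ℝⁿ` with nonnegative coordinates summing to `u`. -/
def scaledSimplex (n : ℕ) (u : ℝ) : Set (EuclideanSpace ℝ (Fin n)) :=
  {θ | (∀ i, 0 ≤ θ i) ∧ ∑ i, θ i = u}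

/-- The tail sum `θ_i + ⋯ + θ_n`. -/
noncomputable def tailSum {n : ℕ} (θ : EuclideanSpace ℝ (Fin n)) (i : Fin n) : ℝ :=
  ∑ k ∈ Finset.Ici i, θ k

/-- The hazard rate order on vectors: `θ ≤_hr θ'`. -/
def HazardRateLE {n : ℕ} (θ θ' : EuclideanSpace ℝ (Fin n)) : Prop :=
  ∀ i j : Fin n, i ≤ j → tailSum θ i * tailSum θ' j ≥ tailSum θ j * tailSum θ' i

/-- The distribution `P_θ` on the real line that gives mass `θ_i` to the point `x_i`. -/
noncomputable def inducedDistribution {n : ℕ} (x : Fin n → ℝ) (θ : EuclideanSpace ℝ (Fin n)) :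
    Measure ℝ :=
  ∑ i, ENNReal.ofReal (θ i) • Measure.dirac (x i)

/-- The hazard rate order on (finite) measures on the real line, in terms of the survival
functions `t ↦ μ (t, ∞)`: `μ ≤_hr ν` if `μ (s, ∞) ν (t, ∞) ≥ μ (t, ∞) ν (s, ∞)` for `s ≤ t`.
The condition does not change when `μ` or `ν` is multiplied by a positive constant. -/
def MeasureHazardRateLE (μ ν : Measure ℝ) : Prop :=
  ∀ s t : ℝ, s ≤ t →
    μ.real (Set.Ioi s) * ν.real (Set.Ioi t) ≥ μ.real (Set.Ioi t) * ν.real (Set.Ioi s)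

/-- `Θ` is uniformly distributed on `Δ^{n,u}` with respect to the `(n-1)`-dimensional volume. -/
def IsUniformOnSimplex {Ω : Type*} [MeasurableSpace Ω] (P : Measure Ω) {n : ℕ} (u : ℝ)
    (Θ : Ω → EuclideanSpace ℝ (Fin n)) : Prop :=
  pdf.IsUniform Θ (scaledSimplex n u) P
    (Measure.euclideanHausdorffMeasure (n - 1) : Measure (EuclideanSpace ℝ (Fin n)))

/-!
A point of the simplex is determined by its tail sums `u = S₀ ≥ S₁ ≥ ⋯ ≥ S_m ≥ 0`, and
`θ ≤_hr θ'` says that each ratio `S_{i+1} / S_i` of `θ` is at most the corresponding ratio of `θ'`.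
Tail sums are linear coordinates, so under the uniform law they are uniform on the set of chains
above, and rescaling the innermost integrals by the outer variables shows that the ratios are
independent, the `i`-th one with density `(m - i) x ^ (m - i - 1)` on `(0, 1)` (breaking a stick).
For independent `Θ` and `Θ'` the `m = n - 1` comparisons of ratios are therefore independent, and
each holds with probability `1 / 2`, being one between two independent copies of an atomless
variable.

The measure `P_θ` has only the values `0` and the tail sums of `θ` as its survival function, so the
order on measures induces the same order on the simplex.
-/

open Matrix (vecCons)

lemma exists_lt_iff_le_of_strictMono {ι X : Type*} [LinearOrder ι] [LocallyFiniteOrderBot ι]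
    [LocallyFiniteOrderTop ι] [LinearOrder X] [DenselyOrdered X] [NoMinOrder X] [NoMaxOrder X]
    [Nonempty X] {x : ι → X} (hx : StrictMono x) (i : ι) :
    ∃ s, ∀ k, s < x k ↔ i ≤ k := by
  obtain ⟨s, hlow, hhigh⟩ := Order.exists_between_finsets
    ((Finset.Iio i).image x) ((Finset.Ici i).image x) fun y hy z hz ↦ by
      obtain ⟨j, hj, rfl⟩ := Finset.mem_image.1 hy
      obtain ⟨k, hk, rfl⟩ := Finset.mem_image.1 hz
      exact hx ((Finset.mem_Iio.1 hj).trans_le (Finset.mem_Ici.1 hk))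
  refine ⟨s, fun k ↦ ⟨fun hk ↦ ?_, fun hk ↦ hhigh _ (Finset.mem_image_of_mem _ (by simpa))⟩⟩
  by_contra! hki
  exact hk.not_gt (hlow _ (Finset.mem_image_of_mem _ (by simpa)))

lemma exists_lt_iff_le_of_lt {ι X : Type*} [LinearOrder ι] [WellFoundedLT ι] [Preorder X]
    {x : ι → X} (hx : Monotone x) {s : X} {j : ι} (hj : s < x j) :
    ∃ i, ∀ k, s < x k ↔ i ≤ k := by
  obtain ⟨i, hi, hmin⟩ := WellFounded.has_min wellFounded_lt {k | s < x k} ⟨j, hj⟩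
  exact ⟨i, fun k ↦ ⟨fun hk ↦ not_lt.1 (hmin k hk), fun hik ↦ lt_of_lt_of_le hi (hx hik)⟩⟩

lemma partialProd_pos {R : Type*} [Semiring R] [PartialOrder R] [IsStrictOrderedRing R]
    {m : ℕ} {r : Fin m → R} (hr : ∀ i, 0 < r i) (i : Fin (m + 1)) : 0 < Fin.partialProd r i := by
  induction i using Fin.induction with
  | zero => simp
  | succ i ih => rw [Fin.partialProd_succ]; exact mul_pos ih (hr i)

lemma continuous_vecCons {X : Type*} [TopologicalSpace X] {m : ℕ} (x : X) :
    Continuous fun t : Fin m → X ↦ vecCons x t :=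
  continuous_const.matrixVecCons continuous_id

lemma measurable_partialProd {M : Type*} [Monoid M] [MeasurableSpace M] [MeasurableMul₂ M] {m : ℕ}
    (j : Fin (m + 1)) : Measurable fun r : Fin m → M ↦ Fin.partialProd r j := by
  induction j using Fin.induction with
  | zero => simp
  | succ j ih =>
    simp only [Fin.partialProd_succ]
    fun_prop

lemma prod_setOf_fst_le_snd {X : Type*} [LinearOrder X] [TopologicalSpace X]
    [OrderClosedTopology X] [SecondCountableTopology X] [MeasurableSpace X] [BorelSpace X]
    (μ : Measure X) [IsProbabilityMeasure μ] [NullSingletonClass μ] :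
    (μ.prod μ) {p | p.1 ≤ p.2} = 1 / 2 := by
  have hle : MeasurableSet {p : X × X | p.1 ≤ p.2} :=
    measurableSet_le measurable_fst measurable_snd
  have hge : MeasurableSet {p : X × X | p.2 ≤ p.1} :=
    measurableSet_le measurable_snd measurable_fst
  have hswap : (μ.prod μ) {p | p.2 ≤ p.1} = (μ.prod μ) {p | p.1 ≤ p.2} :=
    Measure.measurePreserving_swap.measure_preimage hle.nullMeasurableSet
  have hdiag : (μ.prod μ) ({p | p.1 ≤ p.2} ∩ {p | p.2 ≤ p.1}) = 0 := by
    refine (Measure.measure_prod_null (hle.inter hge)).2 (.of_forall fun x ↦ ?_)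
    refine measure_mono_null (fun y hy ↦ ?_) (measure_singleton x)
    exact le_antisymm hy.2 hy.1
  have htotal := measure_union_add_inter {p : X × X | p.1 ≤ p.2} hge (μ := μ.prod μ)
  rw [show {p : X × X | p.1 ≤ p.2} ∪ {p | p.2 ≤ p.1} = Set.univ from
    Set.eq_univ_of_forall fun p ↦ le_total p.1 p.2, measure_univ, hdiag, hswap, ← two_mul,
    add_zero] at htotal
  exact (ENNReal.eq_div_iff two_ne_zero ENNReal.ofNat_ne_top).2 htotal.symm

lemma pi_prod_pi_setOf_fst_le_snd {ι X : Type*} [Fintype ι] [LinearOrder X] [TopologicalSpace X]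
    [OrderClosedTopology X] [SecondCountableTopology X] [MeasurableSpace X] [BorelSpace X]
    (μ : ι → Measure X) [∀ i, IsProbabilityMeasure (μ i)] [∀ i, NullSingletonClass (μ i)] :
    ((Measure.pi μ).prod (Measure.pi μ)) {p | p.1 ≤ p.2} = 1 / 2 ^ Fintype.card ι := by
  rw [← (measurePreserving_arrowProdEquivProdArrow X X ι μ μ).measure_preimage_equiv]
  have hpre : MeasurableEquiv.arrowProdEquivProdArrow X X ι ⁻¹' {p | p.1 ≤ p.2} =
      Set.univ.pi fun _ ↦ {q : X × X | q.1 ≤ q.2} := by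
    ext r
    simp only [Set.mem_univ_pi]
    rfl
  simp only [hpre, Measure.pi_pi, prod_setOf_fst_le_snd, Finset.prod_const, Finset.card_univ,
    one_div, ENNReal.inv_pow]

lemma lintegral_pi_fin_succ {m : ℕ} {X : Fin (m + 1) → Type*} [∀ i, MeasurableSpace (X i)]
    (μ : ∀ i, Measure (X i)) [∀ i, SigmaFinite (μ i)] {f : (∀ i, X i) → ℝ≥0∞}
    (hf : Measurable f) :
    ∫⁻ t, f t ∂Measure.pi μ =
      ∫⁻ s, ∫⁻ t, f (Fin.cons s t) ∂(Measure.pi fun i : Fin m ↦ μ i.succ) ∂μ 0 := by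
  have hmp := (measurePreserving_piFinSuccAbove μ 0).symm
  have hcons (s : X 0) (t : ∀ i : Fin m, X i.succ) :
      (MeasurableEquiv.piFinSuccAbove X 0).symm (s, t) = Fin.cons s t :=
    Fin.insertNth_zero s t
  rw [← hmp.lintegral_comp hf]
  simp only [← hcons]
  exact lintegral_prod _ (hf.comp hmp.measurable).aemeasurable

lemma setLIntegral_Ioo_zero_eq_setLIntegral_Ioo_zero_one {u : ℝ} (hu : 0 < u) (f : ℝ → ℝ≥0∞) :
    ∫⁻ s in Set.Ioo 0 u, f s = ∫⁻ r in Set.Ioo 0 1, ENNReal.ofReal u * f (u * r) := by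
  have h := lintegral_image_eq_lintegral_abs_deriv_mul (measurableSet_Ioo (a := (0 : ℝ)) (b := 1))
    (fun x _ ↦ ((hasDerivAt_id x).const_mul u).hasDerivWithinAt)
    (mul_right_injective₀ hu.ne').injOn f
  simpa [Set.image_mul_left_Ioo hu, abs_of_pos hu] using h

lemma restrict_image_eq_smul_map {X Y : Type*} [MeasurableSpace X] [MeasurableSpace Y]
    {μ : Measure X} {ν : Measure Y} {f : X → Y} (hf : Measurable f) {c : ℝ≥0∞}
    (hν : ∀ s, ν (f '' s) = c * μ s) (s : Set X) :
    ν.restrict (f '' s) = c • (μ.restrict s).map f := by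
  ext A hA
  rw [Measure.restrict_apply hA, ← Set.image_preimage_inter, hν, Measure.smul_apply,
    Measure.map_apply hf hA, Measure.restrict_apply (hf hA), smul_eq_mul]

lemma cond_eq_of_restrict_eq_smul {X : Type*} [MeasurableSpace X] {μ ν : Measure X}
    [IsProbabilityMeasure ν] {s : Set X} {c : ℝ≥0∞} (hc : c ≠ 0) (hc' : c ≠ ∞)
    (h : μ.restrict s = c • ν) : cond μ s = ν := by
  have hs : μ s = c := by
    rw [← Measure.restrict_apply_univ, h, Measure.smul_apply, measure_univ, smul_eq_mul, mul_one]
  rw [ProbabilityTheory.cond, h, hs, smul_smul, ENNReal.inv_mul_cancel hc hc', one_smul]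

lemma exists_euclideanHausdorffMeasure_image_add_eq_mul_volume {ι V : Type*} [Fintype ι]
    [NormedAddCommGroup V] [InnerProductSpace ℝ V] [MeasurableSpace V] [BorelSpace V]
    {L : (ι → ℝ) →ₗ[ℝ] V} (hL : Function.Injective L) :
    ∃ c : ℝ≥0∞, c ≠ 0 ∧ c ≠ ∞ ∧
      ∀ v s, μHE[Fintype.card ι] ((fun t ↦ L t + v) '' s) = c * volume s := by
  let L' : EuclideanSpace ℝ ι →ₗ[ℝ] V := L ∘ₗ (WithLp.linearEquiv 2 ℝ (ι → ℝ)).toLinearMap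
  have hker : LinearMap.ker L' = ⊥ :=
    LinearMap.ker_eq_bot.2 (hL.comp (WithLp.linearEquiv 2 ℝ (ι → ℝ)).injective)
  have hdet : L'.normDet ≠ 0 := fun h ↦ LinearMap.normDet_eq_zero_iff_ker_ne_bot.1 h hker
  refine ⟨ENNReal.ofReal L'.normDet, by simpa using L'.normDet_nonneg.lt_of_ne' hdet,
    ENNReal.ofReal_ne_top, fun v s ↦ ?_⟩
  have himage : (fun t ↦ L t + v) '' s =
      IsometryEquiv.addRight v '' (L' '' (WithLp.ofLp ⁻¹' s)) := by
    nth_rw 1 [← (WithLp.ofLp_surjective 2).image_preimage s]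
    simp only [Set.image_image]
    rfl
  have hvol := L'.euclideanHausdorffMeasure_image_eq_normDet_mul_volume (WithLp.ofLp ⁻¹' s)
  rw [finrank_euclideanSpace] at hvol
  rw [himage, (IsometryEquiv.isometry _).euclideanHausdorffMeasure_image, hvol]
  congr 1
  exact (EuclideanSpace.volume_preserving_symm_measurableEquiv_toLp ι).measure_preimage_equiv s

lemma betaMeasure_one_right {α : ℝ} (hα : 0 < α) :
    betaMeasure α 1 = (volume.restrict (Set.Ioo 0 1)).withDensity
      fun x ↦ ENNReal.ofReal (α * x ^ (α - 1)) := by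
  have hbeta : 1 / beta α 1 = α := by
    rw [beta, Real.Gamma_add_one hα.ne', Real.Gamma_one]
    field_simp [(Real.Gamma_pos_of_pos hα).ne']
  rw [betaMeasure, ← withDensity_indicator measurableSet_Ioo]
  congr 1
  ext x
  rw [betaPDF_eq, hbeta]
  by_cases hx : 0 < x ∧ x < 1 <;> simp [hx]

instance (α β : ℝ) : NullSingletonClass (betaMeasure α β) := by
  unfold betaMeasure; infer_instance

lemma lintegral_betaMeasure_one_right {α : ℝ} (hα : 0 < α) (f : ℝ → ℝ≥0∞) :
    ∫⁻ x, f x ∂betaMeasure α 1 =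
      ∫⁻ x in Set.Ioo 0 1, ENNReal.ofReal (α * x ^ (α - 1)) * f x := by
  rw [betaMeasure_one_right hα, lintegral_withDensity_eq_lintegral_mul_non_measurable _
    (by fun_prop) (.of_forall fun _ ↦ ENNReal.ofReal_lt_top)]
  rfl

instance {m : ℕ} (i : Fin m) : IsProbabilityMeasure (betaMeasure (m - i) 1) :=
  isProbabilityMeasureBeta (sub_pos.2 (Nat.cast_lt.2 i.isLt)) one_pos

/-- The law of the fractions kept at the successive breaks of a stick into `m + 1` pieces:
independent, the `i`-th one with the `Beta(m - i, 1)` distribution (`i` starts at `0`). -/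
noncomputable def stickLaw (m : ℕ) : Measure (Fin m → ℝ) :=
  Measure.pi fun i ↦ betaMeasure (m - i) 1

instance (m : ℕ) : IsProbabilityMeasure (stickLaw m) := by
  unfold stickLaw; infer_instance

lemma stickLaw_zero : stickLaw 0 = volume := by
  rw [stickLaw, volume_pi, Measure.pi_of_empty, Measure.pi_of_empty]

/-- The length that remains of a stick of length `u` after each break, when the `i`-th break keeps
the fraction `r i` of what was left before it. -/
noncomputable def stickRemainders (u : ℝ) {m : ℕ} (r : Fin m → ℝ) : Fin m → ℝ :=
  fun i ↦ u * Fin.partialProd r i.succ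

lemma stickRemainders_cons (u : ℝ) {m : ℕ} (x : ℝ) (r : Fin m → ℝ) :
    stickRemainders u (vecCons x r) = vecCons (u * x) (stickRemainders (u * x) r) := by
  ext i
  rw [stickRemainders, Fin.partialProd_succ']
  cases i using Fin.cases <;> simp [stickRemainders, mul_assoc, Matrix.vecCons]

lemma measurable_stickRemainders (u : ℝ) (m : ℕ) :
    Measurable (stickRemainders u : (Fin m → ℝ) → Fin m → ℝ) :=
  measurable_pi_lambda _ fun i ↦ (measurable_partialProd i.succ).const_mul u

lemma ae_stickLaw_pos (m : ℕ) : ∀ᵐ r ∂stickLaw m, ∀ i, 0 < r i := by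
  refine ae_all_iff.2 fun i ↦ Measure.tendsto_eval_ae_ae.eventually ?_
  have hi : (0 : ℝ) < m - i := sub_pos.2 (Nat.cast_lt.2 i.isLt)
  rw [betaMeasure_one_right hi]
  exact (withDensity_absolutelyContinuous _ _).ae_le <|
    (ae_restrict_mem measurableSet_Ioo).mono fun x hx ↦ hx.1

lemma lintegral_stickLaw_succ {m : ℕ} {f : (Fin (m + 1) → ℝ) → ℝ≥0∞} (hf : Measurable f) :
    ∫⁻ r, f r ∂stickLaw (m + 1) = ∫⁻ x in Set.Ioo 0 1,
      ENNReal.ofReal ((m + 1) * x ^ m) * ∫⁻ r, f (vecCons x r) ∂stickLaw m := by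
  rw [stickLaw, lintegral_pi_fin_succ _ hf]
  simp only [Fin.val_zero, Fin.val_succ, Nat.cast_add, Nat.cast_one, Nat.cast_zero, sub_zero,
    add_sub_add_right_eq_sub]
  rw [lintegral_betaMeasure_one_right (by positivity)]
  simp only [add_sub_cancel_right, Real.rpow_natCast]
  rfl

/-- The chains `u ≥ t₀ ≥ ⋯ ≥ t_{m-1} ≥ 0`: the values on `Δ^{m+1,u}` of all tail sums but the first,
which is always `u`. -/
def tailSumRegion (m : ℕ) (u : ℝ) : Set (Fin m → ℝ) :=
  {t | Antitone (vecCons u t) ∧ 0 ≤ t}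

lemma tailSumRegion_zero (u : ℝ) : tailSumRegion 0 u = Set.univ :=
  Set.eq_univ_of_forall fun _ ↦ ⟨Subsingleton.antitone _, fun i ↦ i.elim0⟩

lemma measurableSet_tailSumRegion (m : ℕ) (u : ℝ) : MeasurableSet (tailSumRegion m u) :=
  ((isClosed_antitone.preimage (continuous_vecCons u)).inter isClosed_Ici).measurableSet

lemma vecCons_mem_tailSumRegion {m : ℕ} {s u : ℝ} {t : Fin m → ℝ} :
    vecCons s t ∈ tailSumRegion (m + 1) u ↔ s ∈ Set.Icc 0 u ∧ t ∈ tailSumRegion m s := by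
  simp only [tailSumRegion, Set.mem_ofPred_eq, antitone_vecCons, Pi.le_def, Fin.forall_fin_succ,
    Matrix.cons_val_zero, Matrix.cons_val_succ, Pi.zero_apply, Set.mem_Icc]
  tauto

lemma setLIntegral_tailSumRegion_succ {m : ℕ} (u : ℝ) {f : (Fin (m + 1) → ℝ) → ℝ≥0∞}
    (hf : Measurable f) :
    ∫⁻ t in tailSumRegion (m + 1) u, f t =
      ∫⁻ s in Set.Ioo 0 u, ∫⁻ t in tailSumRegion m s, f (vecCons s t) := by
  have hregion := measurableSet_tailSumRegion
  rw [setLIntegral_congr Ioo_ae_eq_Icc, ← lintegral_indicator (hregion _ _),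
    ← lintegral_indicator measurableSet_Icc, volume_pi,
    lintegral_pi_fin_succ _ (hf.indicator (hregion _ _))]
  refine lintegral_congr fun s ↦ ?_
  have hslice (t : Fin m → ℝ) : (tailSumRegion (m + 1) u).indicator f (vecCons s t) =
      (Set.Icc 0 u).indicator
        (fun s ↦ (tailSumRegion m s).indicator (fun t ↦ f (vecCons s t)) t) s := by
    classical
    simp only [Set.indicator_apply, vecCons_mem_tailSumRegion, ite_and]
  refine (lintegral_congr hslice).trans ?_
  by_cases hs : s ∈ Set.Icc 0 u
  · simp only [Set.indicator_of_mem hs, lintegral_indicator (hregion _ _), volume_pi]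
  · simp only [Set.indicator_of_notMem hs, lintegral_zero]

theorem setLIntegral_tailSumRegion {m : ℕ} {u : ℝ} (hu : 0 < u) {f : (Fin m → ℝ) → ℝ≥0∞}
    (hf : Measurable f) :
    ∫⁻ t in tailSumRegion m u, f t =
      ENNReal.ofReal (u ^ m / m.factorial) * ∫⁻ r, f (stickRemainders u r) ∂stickLaw m := by
  induction m generalizing u with
  | zero =>
    have hid (r : Fin 0 → ℝ) : stickRemainders u r = r := Subsingleton.elim _ _
    simp only [tailSumRegion_zero, Measure.restrict_univ, stickLaw_zero, hid, pow_zero,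
      Nat.factorial_zero, Nat.cast_one, div_one, ENNReal.ofReal_one, one_mul]
  | succ m ih =>
    have hconst (x : ℝ) : ENNReal.ofReal u * ENNReal.ofReal ((u * x) ^ m / m.factorial) =
        ENNReal.ofReal (u ^ (m + 1) / (m + 1).factorial) * ENNReal.ofReal ((m + 1) * x ^ m) := by
      rw [← ENNReal.ofReal_mul hu.le, ← ENNReal.ofReal_mul (by positivity), Nat.factorial_succ]
      congr 1
      push_cast
      field_simp
      ring
    calc
      ∫⁻ t in tailSumRegion (m + 1) u, f t
        = ∫⁻ s in Set.Ioo 0 u, ENNReal.ofReal (s ^ m / m.factorial) *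
            ∫⁻ r, f (vecCons s (stickRemainders s r)) ∂stickLaw m := by
          rw [setLIntegral_tailSumRegion_succ u hf]
          exact setLIntegral_congr_fun measurableSet_Ioo fun s hs ↦
            ih hs.1 (hf.comp (continuous_vecCons s).measurable)
      _ = ∫⁻ x in Set.Ioo 0 1, ENNReal.ofReal u * (ENNReal.ofReal ((u * x) ^ m / m.factorial) *
            ∫⁻ r, f (vecCons (u * x) (stickRemainders (u * x) r)) ∂stickLaw m) :=
          setLIntegral_Ioo_zero_eq_setLIntegral_Ioo_zero_one hu _
      _ = ∫⁻ x in Set.Ioo 0 1, ENNReal.ofReal (u ^ (m + 1) / (m + 1).factorial) *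
            (ENNReal.ofReal ((m + 1) * x ^ m) *
              ∫⁻ r, f (stickRemainders u (vecCons x r)) ∂stickLaw m) := by
          simp only [← mul_assoc, hconst, stickRemainders_cons]
      _ = ENNReal.ofReal (u ^ (m + 1) / (m + 1).factorial) *
            ∫⁻ r, f (stickRemainders u r) ∂stickLaw (m + 1) := by
          rw [lintegral_const_mul' _ _ ENNReal.ofReal_ne_top]
          exact congrArg _ (lintegral_stickLaw_succ (hf.comp (measurable_stickRemainders u _))).symm

lemma restrict_tailSumRegion (m : ℕ) {u : ℝ} (hu : 0 < u) :
    volume.restrict (tailSumRegion m u) =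
      ENNReal.ofReal (u ^ m / m.factorial) • (stickLaw m).map (stickRemainders u) := by
  refine Measure.ext_of_lintegral _ fun f hf ↦ ?_
  rw [setLIntegral_tailSumRegion hu hf, lintegral_smul_measure,
    lintegral_map hf (measurable_stickRemainders u m), smul_eq_mul]

section TailSums

variable {m : ℕ}

lemma tailSum_castSucc (θ : EuclideanSpace ℝ (Fin (m + 1))) (i : Fin m) :
    tailSum θ i.castSucc = θ i.castSucc + tailSum θ i.succ := by
  have hIoi : Finset.Ioi i.castSucc = Finset.Ici i.succ := by
    ext k
    simp [Fin.castSucc_lt_iff_succ_le]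
  rw [tailSum, tailSum, Finset.Ici_eq_cons_Ioi, Finset.sum_cons, hIoi]

lemma tailSum_last (θ : EuclideanSpace ℝ (Fin (m + 1))) :
    tailSum θ (Fin.last m) = θ (Fin.last m) := by
  have hIci : Finset.Ici (Fin.last m) = {Fin.last m} := by
    ext k
    simp [Fin.last_le_iff]
  rw [tailSum, hIci, Finset.sum_singleton]

lemma tailSum_zero (θ : EuclideanSpace ℝ (Fin (m + 1))) : tailSum θ 0 = ∑ i, θ i := by
  rw [tailSum, ← bot_eq_zero, Finset.Ici_bot]

lemma measurable_tailSum {n : ℕ} (i : Fin n) :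
    Measurable fun θ : EuclideanSpace ℝ (Fin n) ↦ tailSum θ i := by
  unfold tailSum
  fun_prop

lemma measurableSet_hazardRateLE (n : ℕ) :
    MeasurableSet
      {p : EuclideanSpace ℝ (Fin n) × EuclideanSpace ℝ (Fin n) | HazardRateLE p.1 p.2} := by
  simp only [HazardRateLE, Set.ofPred_forall]
  exact .iInter fun i ↦ .iInter fun j ↦ .iInter fun _ ↦ measurableSet_le
    (((measurable_tailSum j).comp measurable_fst).mul ((measurable_tailSum i).comp measurable_snd))
    (((measurable_tailSum i).comp measurable_fst).mul ((measurable_tailSum j).comp measurable_snd))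

lemma tailSum_injective :
    Function.Injective (tailSum : EuclideanSpace ℝ (Fin (m + 1)) → Fin (m + 1) → ℝ) := by
  intro θ θ' h
  ext i
  cases i using Fin.lastCases with
  | last => rw [← tailSum_last, h, tailSum_last]
  | cast i => rw [← add_left_inj, ← tailSum_castSucc, h, tailSum_castSucc]

/-- The tail sums as linear coordinates on `ℝ^{m+1}`. -/
noncomputable def tailSumEquiv (m : ℕ) : EuclideanSpace ℝ (Fin (m + 1)) ≃ₗ[ℝ] (Fin (m + 1) → ℝ) :=
  .ofInjectiveOfFinrankEq
    { toFun := tailSum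
      map_add' := fun θ θ' ↦ by ext i; simp [tailSum, Finset.sum_add_distrib]
      map_smul' := fun c θ ↦ by ext i; simp [tailSum, Finset.mul_sum] }
    tailSum_injective (by simp)

lemma mem_scaledSimplex_iff_tailSum {θ : EuclideanSpace ℝ (Fin (m + 1))} {u : ℝ} :
    θ ∈ scaledSimplex (m + 1) u ↔ tailSum θ 0 = u ∧ Antitone (tailSum θ) ∧ 0 ≤ tailSum θ := by
  rw [tailSum_zero, and_comm, scaledSimplex, Set.mem_ofPred_eq]
  refine and_congr_left fun _ ↦ ⟨fun h ↦ ⟨Fin.antitone_iff_succ_le.2 fun i ↦ ?_, fun i ↦ ?_⟩,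
    fun ⟨hanti, hnonneg⟩ i ↦ ?_⟩
  · linarith [tailSum_castSucc θ i, h i.castSucc]
  · exact Finset.sum_nonneg fun k _ ↦ h k
  · cases i using Fin.lastCases with
    | last => exact (tailSum_last θ).symm ▸ hnonneg (Fin.last m)
    | cast i => linarith [tailSum_castSucc θ i, Fin.antitone_iff_succ_le.1 hanti i]

/-- The vector with tail sums `u, t₀, …, t_{m-1}`. -/
noncomputable def ofTailSums (u : ℝ) (t : Fin m → ℝ) : EuclideanSpace ℝ (Fin (m + 1)) :=
  (tailSumEquiv m).symm (vecCons u t)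

lemma tailSum_ofTailSums (u : ℝ) (t : Fin m → ℝ) : tailSum (ofTailSums u t) = vecCons u t :=
  (tailSumEquiv m).apply_symm_apply _

lemma ofTailSums_tailSum (θ : EuclideanSpace ℝ (Fin (m + 1))) :
    ofTailSums (tailSum θ 0) (fun i ↦ tailSum θ i.succ) = θ := by
  refine tailSum_injective ((tailSum_ofTailSums _ _).trans ?_)
  exact Fin.cons_self_tail (tailSum θ)

lemma ofTailSums_mem_scaledSimplex_iff {u : ℝ} (hu : 0 ≤ u) {t : Fin m → ℝ} :
    ofTailSums u t ∈ scaledSimplex (m + 1) u ↔ t ∈ tailSumRegion m u := by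
  simp [mem_scaledSimplex_iff_tailSum, tailSum_ofTailSums, tailSumRegion, Pi.le_def,
    Fin.forall_fin_succ (n := m), hu]

lemma image_ofTailSums_tailSumRegion {u : ℝ} (hu : 0 ≤ u) :
    ofTailSums u '' tailSumRegion m u = scaledSimplex (m + 1) u := by
  refine Set.Subset.antisymm
    (Set.image_subset_iff.2 fun t ↦ (ofTailSums_mem_scaledSimplex_iff hu).2) fun θ hθ ↦ ?_
  have h0 : tailSum θ 0 = u := (mem_scaledSimplex_iff_tailSum.1 hθ).1
  have hθ' := ofTailSums_tailSum θ
  rw [h0] at hθ'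
  exact ⟨_, (ofTailSums_mem_scaledSimplex_iff hu).1 (hθ'.symm ▸ hθ), hθ'⟩

end TailSums

section UniformLaw

variable {m : ℕ}

lemma ofTailSums_eq_add (u : ℝ) (t : Fin m → ℝ) :
    ofTailSums u t = ofTailSums 0 t + ofTailSums u 0 := by
  rw [ofTailSums, ofTailSums, ofTailSums, ← map_add, Matrix.cons_add_cons, zero_add, add_zero]

lemma measurable_ofTailSums (u : ℝ) : Measurable (ofTailSums (m := m) u) :=
  ((tailSumEquiv m).symm.toLinearMap.continuous_of_finiteDimensional.comp
    (continuous_vecCons u)).measurable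

lemma exists_euclideanHausdorffMeasure_image_ofTailSums (m : ℕ) :
    ∃ c : ℝ≥0∞, c ≠ 0 ∧ c ≠ ∞ ∧ ∀ u (s : Set (Fin m → ℝ)),
      μHE[m] (ofTailSums u '' s) = c * volume s := by
  let L : (Fin m → ℝ) →ₗ[ℝ] EuclideanSpace ℝ (Fin (m + 1)) :=
    (tailSumEquiv m).symm.toLinearMap ∘ₗ LinearMap.vecCons 0 LinearMap.id
  have hL : Function.Injective L :=
    (tailSumEquiv m).symm.injective.comp (Fin.cons_right_injective (α := fun _ ↦ ℝ) 0)
  obtain ⟨c, hc, hc', hvol⟩ := exists_euclideanHausdorffMeasure_image_add_eq_mul_volume hL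
  rw [Fintype.card_fin] at hvol
  refine ⟨c, hc, hc', fun u s ↦ ?_⟩
  rw [← hvol (ofTailSums u 0)]
  exact congrArg _ (congrArg (· '' s) (funext (ofTailSums_eq_add u)))

/-- The lengths of the `m + 1` pieces of a stick of length `u` broken `m` times, the `i`-th break
keeping the fraction `r i` of what was left before it. -/
noncomputable def stickBreaking (u : ℝ) (r : Fin m → ℝ) : EuclideanSpace ℝ (Fin (m + 1)) :=
  ofTailSums u (stickRemainders u r)

lemma measurable_stickBreaking (u : ℝ) : Measurable (stickBreaking (m := m) u) :=
  (measurable_ofTailSums u).comp (measurable_stickRemainders u m)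

lemma tailSum_stickBreaking (u : ℝ) (r : Fin m → ℝ) (i : Fin (m + 1)) :
    tailSum (stickBreaking u r) i = u * Fin.partialProd r i := by
  rw [stickBreaking, tailSum_ofTailSums]
  cases i using Fin.cases <;> simp [stickRemainders]

theorem cond_scaledSimplex_eq_map_stickBreaking (m : ℕ) {u : ℝ} (hu : 0 < u) :
    cond μHE[m] (scaledSimplex (m + 1) u) = (stickLaw m).map (stickBreaking u) := by
  obtain ⟨c, hc, hc', hvol⟩ := exists_euclideanHausdorffMeasure_image_ofTailSums m
  have hΦ := measurable_stickBreaking (m := m) u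
  have : IsProbabilityMeasure ((stickLaw m).map (stickBreaking u)) :=
    Measure.isProbabilityMeasure_map hΦ.aemeasurable
  refine cond_eq_of_restrict_eq_smul (c := c * ENNReal.ofReal (u ^ m / m.factorial))
    (mul_ne_zero hc ?_) (ENNReal.mul_ne_top hc' ENNReal.ofReal_ne_top) ?_
  · exact ENNReal.ofReal_ne_zero_iff.2 (by positivity)
  rw [← image_ofTailSums_tailSumRegion hu.le,
    restrict_image_eq_smul_map (measurable_ofTailSums u) (hvol u), restrict_tailSumRegion m hu,
    Measure.map_smul, Measure.map_map (measurable_ofTailSums u) (measurable_stickRemainders u m),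
    smul_smul]
  rfl

end UniformLaw

section StickOrder

variable {m : ℕ}

lemma hazardRateLE_iff_monotone_div {n : ℕ} {θ θ' : EuclideanSpace ℝ (Fin n)}
    (hθ : ∀ i, 0 < tailSum θ i) :
    HazardRateLE θ θ' ↔ Monotone (tailSum θ' / tailSum θ) := by
  refine forall₃_congr fun i j hij ↦ ?_
  rw [Pi.div_apply, Pi.div_apply, div_le_div_iff₀ (hθ i) (hθ j), ge_iff_le, mul_comm (tailSum θ j),
    mul_comm (tailSum θ i)]

lemma hazardRateLE_stickBreaking_iff {u : ℝ} (hu : 0 < u) {r r' : Fin m → ℝ} (hr : ∀ i, 0 < r i)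
    (hr' : ∀ i, 0 < r' i) :
    HazardRateLE (stickBreaking u r) (stickBreaking u r') ↔ r ≤ r' := by
  have hpos := partialProd_pos hr
  have hpos' := partialProd_pos hr'
  have htail (i) : 0 < tailSum (stickBreaking u r) i := by
    rw [tailSum_stickBreaking]
    exact mul_pos hu (hpos i)
  rw [hazardRateLE_iff_monotone_div htail, Fin.monotone_iff_le_succ]
  refine forall_congr' fun i ↦ ?_
  simp only [Pi.div_apply, tailSum_stickBreaking, mul_div_mul_left _ _ hu.ne', Fin.partialProd_succ,
    mul_div_mul_comm]
  rw [le_mul_iff_one_le_right (div_pos (hpos' _) (hpos _)), one_le_div (hr i)]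

theorem map_stickBreaking_prod_setOf_hazardRateLE (m : ℕ) {u : ℝ} (hu : 0 < u) :
    (((stickLaw m).map (stickBreaking u)).prod ((stickLaw m).map (stickBreaking u)))
      {p | HazardRateLE p.1 p.2} = 1 / 2 ^ m := by
  have hΦ := measurable_stickBreaking (m := m) u
  have hpos := ae_stickLaw_pos m
  rw [Measure.map_prod_map _ _ hΦ hΦ,
    Measure.map_apply (hΦ.prodMap hΦ) (measurableSet_hazardRateLE _)]
  have hle : Prod.map (stickBreaking u) (stickBreaking u) ⁻¹' {p | HazardRateLE p.1 p.2}
      =ᵐ[(stickLaw m).prod (stickLaw m)] {p | p.1 ≤ p.2} := by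
    filter_upwards [Measure.quasiMeasurePreserving_fst.ae hpos,
      Measure.quasiMeasurePreserving_snd.ae hpos] with p hp hp'
    exact propext (hazardRateLE_stickBreaking_iff hu hp hp')
  rw [measure_congr hle, stickLaw, pi_prod_pi_setOf_fst_le_snd, Fintype.card_fin]

end StickOrder

section InducedDistribution

variable {n : ℕ} {x : Fin n → ℝ}

lemma inducedDistribution_real_Ioi (x : Fin n → ℝ) {θ : EuclideanSpace ℝ (Fin n)}
    (hθ : ∀ i, 0 ≤ θ i) (s : ℝ) :
    (inducedDistribution x θ).real (Set.Ioi s) = ∑ i with s < x i, θ i := by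
  have hatom (i : Fin n) : (ENNReal.ofReal (θ i) • Measure.dirac (x i)) (Set.Ioi s) =
      ENNReal.ofReal (if s < x i then θ i else 0) := by
    by_cases hi : s < x i <;> simp [hi]
  have hnonneg (i : Fin n) : 0 ≤ if s < x i then θ i else 0 := by
    split_ifs
    exacts [hθ i, le_rfl]
  rw [Measure.real, inducedDistribution, Measure.finsetSum_apply,
    Finset.sum_congr rfl fun i _ ↦ hatom i, ← ENNReal.ofReal_sum_of_nonneg fun i _ ↦ hnonneg i,
    ENNReal.toReal_ofReal (Finset.sum_nonneg fun i _ ↦ hnonneg i), Finset.sum_filter]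

lemma inducedDistribution_real_Ioi_eq_tailSum {θ : EuclideanSpace ℝ (Fin n)} (hθ : ∀ i, 0 ≤ θ i)
    {s : ℝ} {i : Fin n} (hs : ∀ k, s < x k ↔ i ≤ k) :
    (inducedDistribution x θ).real (Set.Ioi s) = tailSum θ i := by
  rw [inducedDistribution_real_Ioi x hθ, tailSum]
  congr 1
  ext k
  simp only [Finset.mem_filter_univ, Finset.mem_Ici, hs]

lemma measureHazardRateLE_inducedDistribution_iff (hx : StrictMono x)
    {θ θ' : EuclideanSpace ℝ (Fin n)} (hθ : ∀ i, 0 ≤ θ i) (hθ' : ∀ i, 0 ≤ θ' i) :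
    MeasureHazardRateLE (inducedDistribution x θ) (inducedDistribution x θ') ↔
      HazardRateLE θ θ' := by
  have htail {s : ℝ} {i : Fin n} (hs : ∀ k, s < x k ↔ i ≤ k) :=
    And.intro (inducedDistribution_real_Ioi_eq_tailSum hθ hs)
      (inducedDistribution_real_Ioi_eq_tailSum hθ' hs)
  constructor
  · intro H i j hij
    rcases hij.eq_or_lt with rfl | hij
    · exact le_rfl
    obtain ⟨s, hs⟩ := exists_lt_iff_le_of_strictMono hx i
    obtain ⟨t, ht⟩ := exists_lt_iff_le_of_strictMono hx j
    have hst : s ≤ t := ((hs i).2 le_rfl).le.trans (not_lt.1 fun hlt ↦ hij.not_ge ((ht i).1 hlt))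
    simpa only [htail hs, htail ht] using H s t hst
  · intro H s t hst
    by_cases! hex : ∃ j, t < x j
    · obtain ⟨j₀, hj₀⟩ := hex
      obtain ⟨i, hi⟩ := exists_lt_iff_le_of_lt hx.monotone (hst.trans_lt hj₀)
      obtain ⟨j, hj⟩ := exists_lt_iff_le_of_lt hx.monotone hj₀
      simpa only [htail hi, htail hj] using
        H i j ((hi j).1 (hst.trans_lt ((hj j).2 le_rfl)))
    · have hempty : (Finset.univ.filter fun k ↦ t < x k) = ∅ :=
        Finset.filter_eq_empty_iff.2 fun k _ ↦ (hex k).not_gt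
      simp only [inducedDistribution_real_Ioi x hθ t, inducedDistribution_real_Ioi x hθ' t, hempty,
        Finset.sum_empty, mul_zero, zero_mul, ge_iff_le, le_rfl]

end InducedDistribution

lemma measurableSet_scaledSimplex (n : ℕ) (u : ℝ) : MeasurableSet (scaledSimplex n u) := by
  have hinter : scaledSimplex n u = (⋂ i, {θ | 0 ≤ θ i}) ∩ {θ | ∑ i, θ i = u} := by
    ext θ
    simp only [scaledSimplex, Set.mem_inter_iff, Set.mem_iInter, Set.mem_ofPred_eq]
  rw [hinter]
  exact (MeasurableSet.iInter fun i ↦ measurableSet_le measurable_const (by fun_prop)).inter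
    (measurableSet_eq_fun (by fun_prop) measurable_const)

section Uniform

variable {Ω : Type*} [MeasurableSpace Ω] {P : Measure Ω} {u : ℝ}

lemma ae_mem_scaledSimplex_of_isUniformOnSimplex {n : ℕ} {Θ : Ω → EuclideanSpace ℝ (Fin n)}
    (hΘ : Measurable Θ) (hunif : IsUniformOnSimplex P u Θ) :
    ∀ᵐ ω ∂P, Θ ω ∈ scaledSimplex n u := by
  refine ae_of_ae_map (p := (· ∈ scaledSimplex n u)) hΘ.aemeasurable ?_
  rw [show P.map Θ = _ from hunif]
  exact ae_cond_mem (measurableSet_scaledSimplex n u)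

lemma measure_hazardRateLE_of_isUniformOnSimplex [IsProbabilityMeasure P] {m : ℕ}
    {Θ Θ' : Ω → EuclideanSpace ℝ (Fin (m + 1))} (hu : 0 < u) (hΘ : Measurable Θ)
    (hΘ' : Measurable Θ') (hunif : IsUniformOnSimplex P u Θ) (hunif' : IsUniformOnSimplex P u Θ')
    (hindep : IndepFun Θ Θ' P) :
    P {ω | HazardRateLE (Θ ω) (Θ' ω)} = 1 / 2 ^ m := by
  have hlaw : P.map Θ = (stickLaw m).map (stickBreaking u) :=
    hunif.trans (cond_scaledSimplex_eq_map_stickBreaking m hu)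
  have hlaw' : P.map Θ' = (stickLaw m).map (stickBreaking u) :=
    hunif'.trans (cond_scaledSimplex_eq_map_stickBreaking m hu)
  have hjoint : P.map (fun ω ↦ (Θ ω, Θ' ω)) =
      ((stickLaw m).map (stickBreaking u)).prod ((stickLaw m).map (stickBreaking u)) := by
    rw [(indepFun_iff_map_prod_eq_prod_map_map hΘ.aemeasurable hΘ'.aemeasurable).1 hindep, hlaw,
      hlaw']
  rw [← map_stickBreaking_prod_setOf_hazardRateLE m hu, ← hjoint,
    Measure.map_apply (hΘ.prodMk hΘ') (measurableSet_hazardRateLE _), Set.preimage_ofPred_eq]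

end Uniform

theorem mainTheorem1 {Ω : Type*} [MeasurableSpace Ω] (P : Measure Ω) [IsProbabilityMeasure P]
    (n : ℕ) (hn : 1 ≤ n) (u : ℝ) (hu : 0 < u)
    (Θ Θ' : Ω → EuclideanSpace ℝ (Fin n)) (hΘ : Measurable Θ) (hΘ' : Measurable Θ')
    (hunif : IsUniformOnSimplex P u Θ) (hunif' : IsUniformOnSimplex P u Θ')
    (hindep : IndepFun Θ Θ' P) :
    P {ω | HazardRateLE (Θ ω) (Θ' ω)} = 1 / 2 ^ (n - 1) ∧
    ∀ x : Fin n → ℝ, StrictMono x →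
      P {ω | MeasureHazardRateLE (inducedDistribution x (Θ ω)) (inducedDistribution x (Θ' ω))}
        = 1 / 2 ^ (n - 1) := by
  obtain ⟨m, rfl⟩ : ∃ m, n = m + 1 := ⟨n - 1, by omega⟩
  have hprob := measure_hazardRateLE_of_isUniformOnSimplex hu hΘ hΘ' hunif hunif' hindep
  refine ⟨hprob, fun x hx ↦ (measure_congr ?_).trans hprob⟩
  filter_upwards [ae_mem_scaledSimplex_of_isUniformOnSimplex hΘ hunif,
    ae_mem_scaledSimplex_of_isUniformOnSimplex hΘ' hunif'] with ω hω hω'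
  exact propext (measureHazardRateLE_inducedDistribution_iff hx hω.1 hω'.1)
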